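/- **Theorem 1.** Let $\boldsymbol{\sigma}=(\sigma_1,\sigma_2,\sigma_3)$ be the Pauli matrices, and let $A=\tfrac12(\alpha I+\mathbf a\cdot\boldsymbol{\sigma})$ and $B=\tfrac12(\beta I+\mathbf b\cdot\boldsymbol{\sigma})$ be qubit effects, i.e. operators on $\mathbb C^2$ with $0\le A\le I$ and $0\le B\le I$, where $\mathbf a,\mathbf b\in\mathbb R^3$ and $0<\alpha,\beta\le1$. Put $a=\|\mathbf a\|$ and $$\mathfrak S(A)=\tfrac12\Bigl(a^2+\alpha(2-\alpha)-\sqrt{(\alpha^2-a^2)\,[(2-\alpha)^2-a^2]}\Bigr).$$ For $\mathbf a\neq 0$ let $b_\parallel=\mathbf a\cdot\mathbf b/a$ be the component of $\mathbf b$ along $\mathbf a$, let $b_\perp$ be the length of the projection of $\mathbf b$ to the plane perpendicular to $\mathbf a$, and put $$b_0=\frac{(1-\alpha)(1-\beta)}{a},\qquad w=\frac1a\sqrt{(1-\alpha)^2-\beta\,[(1-\alpha)^2+1-a^2]+\beta^2},$$ $$b_\perp^{\max}=\frac1{2a}\sqrt{[(2-\alpha)^2-a^2]\,\{a^2-[a(b_\parallel-b_0)+(1-\beta)]^2\}}+\frac1{2a}\sqrt{[\alpha^2-a^2]\,\{a^2-[a(b_\parallel-b_0)-(1-\beta)]^2\}}.$$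 Call $A$ and $B$ *coexistent* if there are a measurable space $(\Omega,\Sigma)$, a positive-operator-valued measure $\mathsf G$ on it (a $\sigma$-additive map from $\Sigma$ to the effects on $\mathbb C^2$ with $\mathsf G(\Omega)=I$) and events $X,Y\in\Sigma$ with $\mathsf G(X)=A$ and $\mathsf G(Y)=B$. Then $A$ and $B$ are coexistent if and only if one of the following three mutually exclusive cases holds: * (C1) $\beta\le 1-\mathfrak S(A)$; * (C2) $\beta>1-\mathfrak S(A)$ and $|b_\parallel-b_0|\ge w$; * (C3) $\beta>1-\mathfrak S(A)$, $|b_\parallel-b_0|<w$ and $b_\perp\le b_\perp^{\max}$. The expressions are well defined where they are used: the radicand in $\mathfrak S(A)$ is non-negative; if $\beta>1-\mathfrak S(A)$, then $\mathbf a\ne0$ and the radicand in $w$ is non-negative; and if moreover $|b_\parallel-b_0|<w$, then both radicands in $b_\perp^{\max}$ are non-negative. -/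

import Mathlib

noncomputable section

open Matrix MeasureTheory
open scoped ComplexOrder

namespace QubitCoexistence

/-- Operators on the Hilbert space `ℂⁿ` are complex matrices. An operator `A` is an effect if
`0 ≤ A ≤ 1`, i.e. `0 ≤ ⟨ψ, A ψ⟩ ≤ 1` for all unit vectors `ψ`. -/
def IsEffect {n : Type} [Fintype n] [DecidableEq n] (A : Matrix n n ℂ) : Prop :=
  A.PosSemidef ∧ (1 - A).PosSemidef

/-- An observable (POVM, normalized effect-valued measure) on the measurable space `Ω`:
a σ-additive operator-valued set function on the events of `Ω`, all of whose values on events are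
effects, and with value `1` on the whole space. (By the convention of `VectorMeasure`, the
underlying function is `0` on the sets that are not events; these play no role.) -/
structure Observable (Ω : Type) [MeasurableSpace Ω] (n : Type) [Fintype n] [DecidableEq n] where
  /-- the underlying σ-additive set function -/
  toVectorMeasure : VectorMeasure Ω (Matrix n n ℂ)
  isEffect : ∀ X : Set Ω, MeasurableSet X → IsEffect (toVectorMeasure X)
  normalized : toVectorMeasure Set.univ = 1

/-- Two effects are coexistent if both are values of one observable, on some measurable space
of outcomes, at some (not necessarily disjoint) events `X` and `Y`. -/
def Coexistent {n : Type} [Fintype n] [DecidableEq n] (A B : Matrix n n ℂ) : Prop :=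
  ∃ (Ω : Type) (_ : MeasurableSpace Ω) (G : Observable Ω n) (X Y : Set Ω),
    MeasurableSet X ∧ MeasurableSet Y ∧ G.toVectorMeasure X = A ∧ G.toVectorMeasure Y = B

/-- The three Pauli matrices. -/
def pauli : Fin 3 → Matrix (Fin 2) (Fin 2) ℂ :=
  ![!![0, 1; 1, 0], !![0, -Complex.I; Complex.I, 0], !![1, 0; 0, -1]]

/-- The qubit operator `(α I + a · σ) / 2`. -/
def qubitOp (α : ℝ) (a : EuclideanSpace ℝ (Fin 3)) : Matrix (Fin 2) (Fin 2) ℂ :=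
  (1 / 2 : ℂ) • ((α : ℂ) • (1 : Matrix (Fin 2) (Fin 2) ℂ) + ∑ i, ((a i : ℝ) : ℂ) • pauli i)

/-- The radicand `(α² - a²) ((2 - α)² - a²)` in the sharpness. -/
def sharpnessRad (α a : ℝ) : ℝ := (α ^ 2 - a ^ 2) * ((2 - α) ^ 2 - a ^ 2)

/-- The sharpness of the effect with parameters `α` and `a = ‖a‖`. -/
def sharpness (α a : ℝ) : ℝ :=
  (1 / 2) * (a ^ 2 + α * (2 - α) - Real.sqrt (sharpnessRad α a))

/-- The component of `b` in the direction of `a` (used for `a ≠ 0`). -/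
def bPar (a b : EuclideanSpace ℝ (Fin 3)) : ℝ := inner ℝ a b / ‖a‖

/-- The length of the projection of `b` to the plane perpendicular to `a`. -/
def bPerp (a b : EuclideanSpace ℝ (Fin 3)) : ℝ := ‖b - (inner ℝ a b / ‖a‖ ^ 2) • a‖

/-- The centre `b₀` of the interval of restricted parallel components. -/
def bZero (α a β : ℝ) : ℝ := (1 / a) * (1 - α) * (1 - β)

/-- The radicand in the half-width `w`. -/
def widthRad (α a β : ℝ) : ℝ :=
  (1 - α) ^ 2 - β * ((1 - α) ^ 2 + 1 - a ^ 2) + β ^ 2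

/-- The half-width `w` of the interval of restricted parallel components. -/
def width (α a β : ℝ) : ℝ := (1 / a) * Real.sqrt (widthRad α a β)

/-- The first radicand in `b_⊥^max`; `x` is the parallel component of `b`. -/
def perpMaxRad₁ (α a β x : ℝ) : ℝ :=
  ((2 - α) ^ 2 - a ^ 2) * (a ^ 2 - (a * (x - bZero α a β) + (1 - β)) ^ 2)

/-- The second radicand in `b_⊥^max`; `x` is the parallel component of `b`. -/
def perpMaxRad₂ (α a β x : ℝ) : ℝ :=
  (α ^ 2 - a ^ 2) * (a ^ 2 - (a * (x - bZero α a β) - (1 - β)) ^ 2)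

/-- The bound `b_⊥^max`; `x` is the parallel component of `b`. -/
def perpMax (α a β x : ℝ) : ℝ :=
  1 / (2 * a) * Real.sqrt (perpMaxRad₁ α a β x) + 1 / (2 * a) * Real.sqrt (perpMaxRad₂ α a β x)

/-- Case (C1): `β ≤ 1 - S(A)`. -/
def C1 (α : ℝ) (a : EuclideanSpace ℝ (Fin 3)) (β : ℝ) : Prop :=
  β ≤ 1 - sharpness α ‖a‖

/-- Case (C2): `β > 1 - S(A)` and `|b_∥ - b₀| ≥ w`. -/
def C2 (α : ℝ) (a : EuclideanSpace ℝ (Fin 3)) (β : ℝ) (b : EuclideanSpace ℝ (Fin 3)) : Prop :=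
  1 - sharpness α ‖a‖ < β ∧ width α ‖a‖ β ≤ |bPar a b - bZero α ‖a‖ β|

/-- Case (C3): `β > 1 - S(A)`, `|b_∥ - b₀| < w` and `b_⊥ ≤ b_⊥^max`. -/
def C3 (α : ℝ) (a : EuclideanSpace ℝ (Fin 3)) (β : ℝ) (b : EuclideanSpace ℝ (Fin 3)) : Prop :=
  1 - sharpness α ‖a‖ < β ∧ |bPar a b - bZero α ‖a‖ β| < width α ‖a‖ β ∧
    bPerp a b ≤ perpMax α ‖a‖ β (bPar a b)

end QubitCoexistence

end

open QubitCoexistence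

/-!
Two effects `A`, `B` are coexistent iff there is a joint effect `G` with `0 ≤ G ≤ A`, `G ≤ B` and
`A + B - 1 ≤ G` (`coexistent_iff_exists_posSemidef`), in other words iff `B` is a sum `P + Q` of
points `P`, `Q` of the order intervals `[0, A]` and `[0, 1 - A]`. For a qubit the positive operators
are the forward light cone of Minkowski space (`posSemidef_qubitOp_iff`), and orthogonal projection
reduces the question to the plane of `a` and `b` (`coexistent_iff_planarCoexistent`).

The Minkowski sum of the two order intervals has two kinds of boundary points.

* Where `B` has rank one, `P` and `Q` have to be multiples of `B`, and comparing the largest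
  multiples of `B` below `A` and below `1 - A` with `B` itself gives the condition `|b_∥ - b₀| ≥ w`
  (`planarCoexistent_of_rank_one`). It extends to all `B` with the same parallel component by
  mixing. The radicand of `w` is a quadratic polynomial in `β` whose larger root is `1 - 𝔖(A)`; at
  that root the condition holds for every direction of `B`, and since it is inherited by the
  multiples `c B` with `c ≤ 1`, everything with `β ≤ 1 - 𝔖(A)` is coexistent with `A`.
* Elsewhere `P` and `Q` lie on the ellipses in which the light cones bounding `[0, A]`, respectively
  `[0, 1 - A]`, meet. The trace and the parallel component of `B` fix the position `t`, `s` on the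
  ellipses, and `b_⊥^max` is the sum of their heights there (`exists_ellipse_coordinates`). For the
  converse bound, the null vectors `P`, `A - P`, `Q`, `1 - A - Q` satisfy a linear relation whose
  signs are governed by the cyclic order of their directions. For `|b_∥ - b₀| ≤ w` the directions
  interlace, and the relation yields a functional that is maximal over `[0, A]` at `P` and over
  `[0, 1 - A]` at `Q` (`perp_le_of_balance`, `perp_le_of_interlacing`).
-/

noncomputable section

open Matrix MeasureTheory
open scoped ComplexOrder

namespace QubitCoexistence

/-! ### Reduction to a joint four-outcome decomposition -/

section Observables

variable {n : Type} [Fintype n] [DecidableEq n]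

/-- The observable with finitely many outcomes `i`, each carrying the operator `E i`. -/
def Observable.ofFintype {ι : Type} [Fintype ι] [MeasurableSpace ι] [DiscreteMeasurableSpace ι]
    (E : ι → Matrix n n ℂ) (hE : ∀ i, (E i).PosSemidef) (hsum : ∑ i, E i = 1) : Observable ι n :=
  { toVectorMeasure :=
      { measureOf' := fun s => ∑ i, s.indicator E i
        empty' := by simp
        not_measurable' := fun s hs => absurd (MeasurableSet.of_discrete) hs
        m_iUnion' := fun f hf hd => by
          refine hasSum_sum fun i _ => ?_
          by_cases hi : ∃ k, i ∈ f k
          · obtain ⟨k, hk⟩ := hi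
            rw [Set.indicator_of_mem (Set.mem_iUnion_of_mem k hk)]
            have h := hasSum_single (f := fun m => (f m).indicator E i) k fun m hm =>
              Set.indicator_of_notMem (fun him => Set.disjoint_left.1 (hd hm) him hk) E
            simpa only [Set.indicator_of_mem hk] using h
          · rw [Set.indicator_of_notMem (by simpa using hi)]
            convert hasSum_zero using 2 with m
            exact Set.indicator_of_notMem (fun h => hi ⟨m, h⟩) E }
    isEffect := fun X _ => by
      have key : ∀ Y : Set ι, (∑ i, Y.indicator E i).PosSemidef := fun Y =>
        posSemidef_sum _ fun i _ => by
          by_cases hi : i ∈ Y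
          · rw [Set.indicator_of_mem hi]; exact hE i
          · rw [Set.indicator_of_notMem hi]; exact PosSemidef.zero
      refine ⟨key X, ?_⟩
      have h : (1 : Matrix n n ℂ) - ∑ i, X.indicator E i = ∑ i, Xᶜ.indicator E i := by
        rw [← hsum, ← Finset.sum_sub_distrib]
        exact Finset.sum_congr rfl fun i _ => by rw [Set.indicator_compl]; rfl
      change ((1 : Matrix n n ℂ) - ∑ i, X.indicator E i).PosSemidef
      rw [h]
      exact key _
    normalized := by
      change ∑ i, Set.univ.indicator E i = 1
      simpa using hsum }

theorem Observable.ofFintype_apply {ι : Type} [Fintype ι] [MeasurableSpace ι]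
    [DiscreteMeasurableSpace ι] {E : ι → Matrix n n ℂ} {hE : ∀ i, (E i).PosSemidef}
    {hsum : ∑ i, E i = 1} (s : Set ι) :
    (Observable.ofFintype E hE hsum).toVectorMeasure s = ∑ i, s.indicator E i := rfl

/-- Coexistence is the existence of an operator `G`, playing the role of the joint event `X ∩ Y`,
such that `G`, `A - G`, `B - G` and `1 - A - B + G` are all positive. -/
theorem coexistent_iff_exists_posSemidef {A B : Matrix n n ℂ} :
    Coexistent A B ↔ ∃ G : Matrix n n ℂ, G.PosSemidef ∧ (A - G).PosSemidef ∧
      (B - G).PosSemidef ∧ (1 - A - B + G).PosSemidef := by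
  constructor
  · rintro ⟨Ω, _, O, X, Y, hX, hY, rfl, rfl⟩
    have hXY := hX.inter hY
    refine ⟨O.toVectorMeasure (X ∩ Y), (O.isEffect _ hXY).1, ?_, ?_, ?_⟩
    · rw [← VectorMeasure.of_sdiff hXY hX Set.inter_subset_left]
      exact (O.isEffect _ (hX.diff hXY)).1
    · rw [← VectorMeasure.of_sdiff hXY hY Set.inter_subset_right]
      exact (O.isEffect _ (hY.diff hXY)).1
    · have h := VectorMeasure.of_union (v := O.toVectorMeasure)
        (Set.disjoint_sdiff_right (s := X) (t := Y)) hX (hY.diff hX)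
      have h' := VectorMeasure.of_sdiff (v := O.toVectorMeasure) hXY hY Set.inter_subset_right
      rw [Set.sdiff_inter_self_eq_sdiff] at h'
      have e : 1 - O.toVectorMeasure X - O.toVectorMeasure Y + O.toVectorMeasure (X ∩ Y)
          = 1 - O.toVectorMeasure (X ∪ (Y \ X)) := by
        rw [h, h']; abel
      rw [e]
      exact (O.isEffect _ (hX.union (hY.diff hX))).2
  · rintro ⟨G, h₁, h₂, h₃, h₄⟩
    refine ⟨Fin 4, inferInstance, Observable.ofFintype ![G, A - G, B - G, 1 - A - B + G] ?_ ?_,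
      {0, 1}, {0, 2}, .of_discrete, .of_discrete, ?_, ?_⟩
    · intro i
      fin_cases i <;> assumption
    · simp only [Fin.sum_univ_four, Matrix.cons_val]
      abel
    · refine (Observable.ofFintype_apply _).trans ?_
      simp [Fin.sum_univ_four, Set.indicator]
    · refine (Observable.ofFintype_apply _).trans ?_
      simp [Fin.sum_univ_four, Set.indicator]

end Observables

/-! ### Positivity of qubit operators -/

theorem qubitOp_eq (α : ℝ) (a : EuclideanSpace ℝ (Fin 3)) :
    qubitOp α a = (1 / 2 : ℂ) • !![(α + a 2 : ℂ), a 0 - a 1 * Complex.I;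
      a 0 + a 1 * Complex.I, (α - a 2 : ℂ)] := by
  ext i j
  fin_cases i <;> fin_cases j <;> simp [qubitOp, pauli, Fin.sum_univ_three] <;> ring

theorem qubitOp_add (α β : ℝ) (a b : EuclideanSpace ℝ (Fin 3)) :
    qubitOp (α + β) (a + b) = qubitOp α a + qubitOp β b := by
  simp only [qubitOp_eq]
  ext i j
  fin_cases i <;> fin_cases j <;> simp <;> ring

theorem qubitOp_sub (α β : ℝ) (a b : EuclideanSpace ℝ (Fin 3)) :
    qubitOp (α - β) (a - b) = qubitOp α a - qubitOp β b := by
  rw [eq_sub_iff_add_eq, ← qubitOp_add, sub_add_cancel, sub_add_cancel]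

theorem qubitOp_two_zero : qubitOp 2 0 = 1 := by
  simp only [qubitOp_eq]
  ext i j
  fin_cases i <;> fin_cases j <;> simp

theorem exists_qubitOp_of_isHermitian {G : Matrix (Fin 2) (Fin 2) ℂ} (hG : G.IsHermitian) :
    ∃ γ g, G = qubitOp γ g := by
  refine ⟨(G 0 0).re + (G 1 1).re,
    !₂[2 * (G 1 0).re, 2 * (G 1 0).im, (G 0 0).re - (G 1 1).re], ?_⟩
  have h00 := Complex.ext_iff.1 (hG.apply 0 0)
  have h01 := Complex.ext_iff.1 (hG.apply 0 1)
  have h11 := Complex.ext_iff.1 (hG.apply 1 1)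
  simp at h00 h01 h11
  rw [qubitOp_eq]
  ext i j
  fin_cases i <;> fin_cases j <;> apply Complex.ext <;> simp <;> grind

theorem norm_sq_eq (a : EuclideanSpace ℝ (Fin 3)) : ‖a‖ ^ 2 = a 0 ^ 2 + a 1 ^ 2 + a 2 ^ 2 := by
  simp [EuclideanSpace.norm_sq_eq, Fin.sum_univ_three]

/-- Under the identification of Hermitian `2 × 2` matrices with Minkowski space, the positive
operators form the forward light cone. -/
theorem posSemidef_qubitOp_iff {α : ℝ} {a : EuclideanSpace ℝ (Fin 3)} :
    (qubitOp α a).PosSemidef ↔ ‖a‖ ≤ α := by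
  have hdet : (qubitOp α a).det = (((α ^ 2 - ‖a‖ ^ 2) / 4 : ℝ) : ℂ) := by
    rw [norm_sq_eq, qubitOp_eq, Matrix.det_smul, Matrix.det_fin_two_of]
    push_cast
    simp
    linear_combination ((a 1 : ℂ) ^ 2 / 4) * Complex.I_sq
  have htr : (qubitOp α a).trace = (α : ℂ) := by
    rw [qubitOp_eq, Matrix.trace_smul, Matrix.trace_fin_two_of]
    simp; ring
  constructor
  · intro h
    have h₁ := h.det_nonneg
    have h₂ := h.trace_nonneg
    rw [hdet] at h₁
    rw [htr] at h₂
    norm_cast at h₁ h₂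
    exact abs_le_of_sq_le_sq' (by linarith) h₂ |>.2
  · intro h
    have hα : 0 ≤ α := (norm_nonneg a).trans h
    have hH : (qubitOp α a)ᴴ = qubitOp α a := by
      rw [qubitOp_eq]
      ext i j
      fin_cases i <;> fin_cases j <;> apply Complex.ext <;> simp
    rcases hα.eq_or_lt with rfl | hα
    · have ha : a = 0 := norm_le_zero_iff.1 h
      have : qubitOp 0 a = 0 := by simp [qubitOp, ha]
      rw [this]
      exact PosSemidef.zero
    · -- by Cayley–Hamilton, `α M = M² + det M`
      have hd : 0 ≤ (α ^ 2 - ‖a‖ ^ 2) / 4 := by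
        have := norm_nonneg a
        nlinarith
      have e : qubitOp α a = ((α⁻¹ : ℝ) : ℂ) • ((qubitOp α a)ᴴ * qubitOp α a
          + (((α ^ 2 - ‖a‖ ^ 2) / 4 : ℝ) : ℂ) • (1 : Matrix (Fin 2) (Fin 2) ℂ)) := by
        have hα' : (α : ℂ) ≠ 0 := by exact_mod_cast hα.ne'
        rw [hH, Complex.ofReal_inv, eq_inv_smul_iff₀ hα', norm_sq_eq, qubitOp_eq]
        ext i j
        have hI := Complex.I_sq
        fin_cases i <;> fin_cases j <;> simp <;> grind
      rw [e]
      refine ((posSemidef_conjTranspose_mul_self _).add (PosSemidef.one.smul ?_)).smul ?_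
      · exact_mod_cast hd
      · exact_mod_cast (inv_pos.2 hα).le

theorem isEffect_qubitOp_iff {α : ℝ} {a : EuclideanSpace ℝ (Fin 3)} :
    IsEffect (qubitOp α a) ↔ ‖a‖ ≤ α ∧ ‖a‖ ≤ 2 - α := by
  rw [IsEffect, ← qubitOp_two_zero, ← qubitOp_sub, posSemidef_qubitOp_iff, posSemidef_qubitOp_iff,
    zero_sub, norm_neg]

/-- The joint decomposition in terms of Bloch vectors: the four balls with centres `0`, `a`, `b`,
`a + b` and radii `γ`, `α - γ`, `β - γ`, `2 - α - β + γ` have a common point `g`. -/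
theorem coexistent_qubitOp_iff {α β : ℝ} {a b : EuclideanSpace ℝ (Fin 3)} :
    Coexistent (qubitOp α a) (qubitOp β b) ↔ ∃ (γ : ℝ) (g : EuclideanSpace ℝ (Fin 3)),
      ‖g‖ ≤ γ ∧ ‖a - g‖ ≤ α - γ ∧ ‖b - g‖ ≤ β - γ ∧ ‖0 - a - b + g‖ ≤ 2 - α - β + γ := by
  simp only [coexistent_iff_exists_posSemidef, ← posSemidef_qubitOp_iff, qubitOp_add, qubitOp_sub,
    qubitOp_two_zero]
  refine ⟨fun ⟨G, hG⟩ => ?_, fun ⟨γ, g, h⟩ => ⟨_, h⟩⟩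
  obtain ⟨γ, g, rfl⟩ := exists_qubitOp_of_isHermitian hG.1.isHermitian
  exact ⟨γ, g, hG⟩

/-! ### Reduction to the plane spanned by the Bloch vectors -/

/-- The forward light cone of (2+1)-dimensional Minkowski space, `c` being the time coordinate. -/
def InCone (c x y : ℝ) : Prop := 0 ≤ c ∧ x ^ 2 + y ^ 2 ≤ c ^ 2

/-- Coexistence of the effects with Bloch vectors `(a, 0)` and `(x, y)` in a plane, written as a
decomposition `B = P + Q` with `P = (γ, p, r)` in the order interval `[0, A]` and
`Q = B - P` in `[0, 1 - A]`. -/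
def PlanarCoexistent (α a β x y : ℝ) : Prop :=
  ∃ γ p r : ℝ, InCone γ p r ∧ InCone (α - γ) (a - p) (-r) ∧
    InCone (β - γ) (x - p) (y - r) ∧ InCone (2 - α - (β - γ)) (-a - (x - p)) (-(y - r))

section Plane

variable {E : Type*} [NormedAddCommGroup E] [InnerProductSpace ℝ E] {e n : E}

theorem norm_sq_smul_add_smul (he : ‖e‖ = 1) (hn : ‖n‖ = 1) (hen : inner ℝ e n = 0) (x y : ℝ) :
    ‖x • e + y • n‖ ^ 2 = x ^ 2 + y ^ 2 := by
  rw [norm_add_sq_real, inner_smul_left, inner_smul_right, hen, norm_smul, norm_smul, he, hn]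
  simp

theorem InCone.norm_le (he : ‖e‖ = 1) (hn : ‖n‖ = 1) (hen : inner ℝ e n = 0) {c x y : ℝ}
    (h : InCone c x y) : ‖x • e + y • n‖ ≤ c :=
  abs_le_of_sq_le_sq' ((norm_sq_smul_add_smul he hn hen x y).trans_le h.2) h.1 |>.2

theorem inCone_of_norm_le (he : ‖e‖ = 1) (hn : ‖n‖ = 1) (hen : inner ℝ e n = 0) {c : ℝ} {v : E}
    (h : ‖v‖ ≤ c) : InCone c (inner ℝ e v) (inner ℝ n v) := by
  refine ⟨(norm_nonneg v).trans h, ?_⟩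
  have h₁ : ‖v - (inner ℝ e v • e + inner ℝ n v • n)‖ ^ 2
      = ‖v‖ ^ 2 - (inner ℝ e v ^ 2 + inner ℝ n v ^ 2) := by
    rw [norm_sub_sq_real, norm_sq_smul_add_smul he hn hen, inner_add_right, inner_smul_right,
      inner_smul_right, real_inner_comm e v, real_inner_comm n v]
    ring
  have h₂ := sq_nonneg ‖v - (inner ℝ e v • e + inner ℝ n v • n)‖
  have h₃ := pow_le_pow_left₀ (norm_nonneg v) h 2
  linarith

end Plane

theorem exists_unit_orthogonal {e : EuclideanSpace ℝ (Fin 3)} (he : ‖e‖ = 1)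
    (b : EuclideanSpace ℝ (Fin 3)) : ∃ n : EuclideanSpace ℝ (Fin 3), ‖n‖ = 1 ∧ inner ℝ e n = 0 ∧
      b = inner ℝ e b • e + ‖b - inner ℝ e b • e‖ • n := by
  by_cases hb : b - inner ℝ e b • e = 0
  · obtain ⟨v, hv, hv0⟩ := Submodule.exists_mem_ne_zero_of_ne_bot (p := (ℝ ∙ e)ᗮ) (by
      intro h
      have h₁ := Submodule.finrank_add_finrank_orthogonal (ℝ ∙ e)
      have h₂ := finrank_span_le_card (R := ℝ) ({e} : Set (EuclideanSpace ℝ (Fin 3)))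
      rw [h, finrank_bot, finrank_euclideanSpace_fin] at h₁
      simp at h₂
      omega)
    refine ⟨‖v‖⁻¹ • v, norm_smul_inv_norm hv0, ?_, ?_⟩
    · rw [inner_smul_right, Submodule.mem_orthogonal_singleton_iff_inner_right.1 hv, mul_zero]
    · rw [hb, norm_zero, zero_smul, add_zero]
      exact sub_eq_zero.1 hb
  · refine ⟨‖b - inner ℝ e b • e‖⁻¹ • (b - inner ℝ e b • e), norm_smul_inv_norm hb, ?_, ?_⟩
    · rw [inner_smul_right, inner_sub_right, inner_smul_right, real_inner_self_eq_norm_sq, he]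
      simp
    · rw [smul_inv_smul₀ (norm_ne_zero_iff.2 hb)]
      abel

/-- A joint decomposition can be projected orthogonally to the plane of `a` and `b`. -/
theorem coexistent_iff_planarCoexistent {α β : ℝ} {a b e : EuclideanSpace ℝ (Fin 3)}
    (he : ‖e‖ = 1) (ha : a = ‖a‖ • e) : Coexistent (qubitOp α a) (qubitOp β b) ↔
      PlanarCoexistent α ‖a‖ β (inner ℝ e b) ‖b - inner ℝ e b • e‖ := by
  obtain ⟨n, hn, hen, hb⟩ := exists_unit_orthogonal he b
  set x := inner ℝ e b
  set y := ‖b - x • e‖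
  have hae : inner ℝ e a = ‖a‖ := by
    conv_lhs => rw [ha, inner_smul_right, real_inner_self_eq_norm_sq, he]
    simp
  have han : inner ℝ n a = 0 := by
    conv_lhs => rw [ha, inner_smul_right, real_inner_comm, hen]
    simp
  have hbn : inner ℝ n b = y := by
    conv_lhs => rw [hb, inner_add_right, inner_smul_right, inner_smul_right, real_inner_comm, hen,
      real_inner_self_eq_norm_sq, hn]
    simp
  rw [coexistent_qubitOp_iff]
  constructor
  · rintro ⟨γ, g, h₁, h₂, h₃, h₄⟩
    refine ⟨γ, inner ℝ e g, inner ℝ n g, inCone_of_norm_le he hn hen h₁, ?_, ?_, ?_⟩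
    · convert inCone_of_norm_le he hn hen h₂ using 1
      · rw [inner_sub_right, hae]
      · rw [inner_sub_right, han, zero_sub]
    · convert inCone_of_norm_le he hn hen h₃ using 1
      · rw [inner_sub_right]
      · rw [inner_sub_right, hbn]
    · convert inCone_of_norm_le he hn hen h₄ using 1
      · ring
      · simp only [inner_add_right, inner_sub_right, hae, inner_zero_right]
        ring
      · simp only [inner_add_right, inner_sub_right, han, hbn, inner_zero_right]
        ring
  · rintro ⟨γ, p, r, h₁, h₂, h₃, h₄⟩
    refine ⟨γ, p • e + r • n, h₁.norm_le he hn hen, ?_, ?_, ?_⟩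
    · have h : a - (p • e + r • n) = (‖a‖ - p) • e + (-r) • n := by
        conv_lhs => rw [ha]
        module
      exact h ▸ h₂.norm_le he hn hen
    · have h : b - (p • e + r • n) = (x - p) • e + (y - r) • n := by
        conv_lhs => rw [hb]
        module
      exact h ▸ h₃.norm_le he hn hen
    · have h : 0 - a - b + (p • e + r • n) = (-‖a‖ - (x - p)) • e + (-(y - r)) • n := by
        conv_lhs => rw [ha, hb]
        module
      rw [h]
      exact (h₄.norm_le he hn hen).trans_eq (by ring)

/-! ### Sufficient conditions in the plane -/

variable {α a β x y : ℝ}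

/-- Shrinking the component of all vectors perpendicular to `a` preserves the light cone. -/
theorem PlanarCoexistent.of_abs_le {y' : ℝ} (h : PlanarCoexistent α a β x y) (hy : |y'| ≤ |y|) :
    PlanarCoexistent α a β x y' := by
  obtain ⟨γ, p, r, h₁, h₂, h₃, h₄⟩ := h
  obtain ⟨θ, hθ, rfl⟩ : ∃ θ : ℝ, θ ^ 2 ≤ 1 ∧ y' = θ * y := by
    refine ⟨y' / y, ?_, ?_⟩
    · rw [sq_le_one_iff_abs_le_one, abs_div]
      exact div_le_one_of_le₀ hy (abs_nonneg y)
    · rcases eq_or_ne y 0 with rfl | h0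
      · simpa using hy
      · field_simp
  have key : ∀ {c u v : ℝ}, InCone c u v → InCone c u (θ * v) := fun {c u v} h =>
    ⟨h.1, by have := mul_le_mul_of_nonneg_right hθ (sq_nonneg v); nlinarith [h.2]⟩
  refine ⟨γ, p, θ * r, key h₁, ?_, ?_, ?_⟩
  · convert key h₂ using 1; ring
  · convert key h₃ using 1; ring
  · convert key h₄ using 1; ring

theorem InCone.smul {c : ℝ} (hc : 0 ≤ c) (h : InCone β x y) : InCone (c * β) (c * x) (c * y) :=
  ⟨mul_nonneg hc h.1, by
    have := mul_le_mul_of_nonneg_left h.2 (sq_nonneg c)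
    nlinarith⟩

/-- If `B` has rank one, it suffices to distribute `B` itself over `A` and `1 - A`. The largest
multiple `c B ≤ A` has `c = (α² - a²) / (2 (αβ - a x))` and the largest `c' B ≤ 1 - A` has
`c' = ((2 - α)² - a²) / (2 ((2 - α) β + a x))`; the hypothesis `h` says that `c + c' ≥ 1`. -/
theorem planarCoexistent_of_rank_one (ha : 0 ≤ a) (haα : a ≤ α) (hα : α ≤ 1) (hβ₀ : 0 < β)
    (hβ : β ≤ 1) (hxy : x ^ 2 + y ^ 2 = β ^ 2)
    (h : 2 * (α * β - a * x) * (2 * ((2 - α) * β + a * x)) ≤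
      (α ^ 2 - a ^ 2) * (2 * ((2 - α) * β + a * x)) +
        ((2 - α) ^ 2 - a ^ 2) * (2 * (α * β - a * x))) :
    PlanarCoexistent α a β x y := by
  have hB : InCone β x y := ⟨hβ₀.le, hxy.le⟩
  have hx : |x| ≤ β := abs_le_of_sq_le_sq (by nlinarith [sq_nonneg y]) hβ₀.le
  obtain ⟨hx₁, hx₂⟩ := abs_le.1 hx
  have hax : a * x ≤ a * β := mul_le_mul_of_nonneg_left hx₂ ha
  have hax' : -(a * β) ≤ a * x := by nlinarith
  have hαβ : a * β ≤ α * β := mul_le_mul_of_nonneg_right haα hβ₀.le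
  set U := 2 * (α * β - a * x) with hU
  set V := 2 * ((2 - α) * β + a * x) with hV
  have hU0 : 0 ≤ U := by rw [hU]; linarith
  have hV0 : 0 ≤ V := by rw [hV]; nlinarith
  have hK : 0 ≤ α ^ 2 - a ^ 2 := by nlinarith
  suffices hc : ∃ c : ℝ, 0 ≤ c ∧ c ≤ 1 ∧ c * β ≤ α ∧ c * U ≤ α ^ 2 - a ^ 2 ∧
      (1 - c) * V ≤ (2 - α) ^ 2 - a ^ 2 by
    obtain ⟨c, hc0, hc1, hcβ, hcU, hcV⟩ := hc
    have hcβ' : (1 - c) * β ≤ β := by nlinarith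
    refine ⟨c * β, c * x, c * y, hB.smul hc0, ⟨by linarith, ?_⟩, ?_, ⟨by linarith, ?_⟩⟩
    · rw [hU] at hcU
      linear_combination hcU + c ^ 2 * hxy
    · convert hB.smul (sub_nonneg.2 hc1) using 1 <;> ring
    · rw [hV] at hcV
      linear_combination hcV + (1 - c) ^ 2 * hxy
  rcases haα.eq_or_lt with rfl | haα
  · -- `A` is a multiple of a projection
    rcases hU0.eq_or_lt with hU0 | hU0
    · rcases le_total β a with hβa | hβa
      · exact ⟨1, zero_le_one, le_rfl, by linarith, by linarith, by nlinarith⟩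
      · have hd : a / β * β = a := div_mul_cancel₀ a hβ₀.ne'
        refine ⟨a / β, by positivity, div_le_one_of_le₀ hβa hβ₀.le, hd.le, by
          rw [← hU0]; linarith, ?_⟩
        have hVβ : V = 4 * β - U := by rw [hV, hU]; ring
        rw [hVβ, ← hU0]
        nlinarith
    · refine ⟨0, le_rfl, zero_le_one, by linarith, by linarith, ?_⟩
      refine le_of_mul_le_mul_right ?_ hU0
      linarith
  · have hU0 : 0 < U := by rw [hU]; nlinarith
    have hβU : 2 * (α - a) * β ≤ U := by rw [hU]; linarith
    rcases le_total U (α ^ 2 - a ^ 2) with hUK | hUK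
    · refine ⟨1, zero_le_one, le_rfl, ?_, by linarith, by nlinarith⟩
      nlinarith
    · have hd : (α ^ 2 - a ^ 2) / U * U = α ^ 2 - a ^ 2 := div_mul_cancel₀ _ hU0.ne'
      have hc0 : 0 ≤ (α ^ 2 - a ^ 2) / U := by positivity
      refine ⟨(α ^ 2 - a ^ 2) / U, hc0, div_le_one_of_le₀ hUK hU0.le, ?_, hd.le, ?_⟩
      · have := mul_le_mul_of_nonneg_left hβU hc0
        rw [hd] at this
        have h' : (α ^ 2 - a ^ 2) / U * β * (2 * (α - a)) ≤ (α + a) * (α - a) := by linarith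
        nlinarith
      · refine le_of_mul_le_mul_right ?_ hU0
        have : (1 - (α ^ 2 - a ^ 2) / U) * V * U = U * V - (α ^ 2 - a ^ 2) * V := by
          rw [← hd]; field_simp
        rw [this]
        linarith

/-- Every positive `B ≠ 0` is a mixture of the two rank one effects with the same trace and the
same component along `a`. -/
theorem planarCoexistent_of_le (ha : 0 ≤ a) (haα : a ≤ α) (hα : α ≤ 1) (hβ₀ : 0 < β)
    (hβ : β ≤ 1) (hxy : x ^ 2 + y ^ 2 ≤ β ^ 2)
    (h : 2 * (α * β - a * x) * (2 * ((2 - α) * β + a * x)) ≤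
      (α ^ 2 - a ^ 2) * (2 * ((2 - α) * β + a * x)) +
        ((2 - α) ^ 2 - a ^ 2) * (2 * (α * β - a * x))) :
    PlanarCoexistent α a β x y := by
  have h0 : 0 ≤ β ^ 2 - x ^ 2 := by nlinarith [sq_nonneg y]
  refine (planarCoexistent_of_rank_one (y := √(β ^ 2 - x ^ 2)) ha haα hα hβ₀ hβ ?_ h).of_abs_le ?_
  · rw [Real.sq_sqrt h0]; ring
  · rw [abs_of_nonneg (Real.sqrt_nonneg _)]
    exact Real.abs_le_sqrt (by linarith)

/-- The points `P = (α + t a, a + t α, p) / 2` and `Q = (2 - α - s a, -a + s (2 - α), q) / 2` of the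
ellipses in which the boundary cones of the order intervals `[0, A]` and `[0, 1 - A]` meet. -/
theorem planarCoexistent_of_ellipses {s t p q : ℝ} (ha : 0 ≤ a) (haα : a ≤ α) (hα : α ≤ 1)
    (hs : |s| ≤ 1) (ht : |t| ≤ 1) (hp : p ^ 2 = (α ^ 2 - a ^ 2) * (1 - t ^ 2))
    (hq : q ^ 2 = ((2 - α) ^ 2 - a ^ 2) * (1 - s ^ 2)) (hβ : 2 * β = 2 + a * (t - s))
    (hx : 2 * x = α * t + (2 - α) * s) : PlanarCoexistent α a β x ((p + q) / 2) := by
  obtain ⟨hs₁, hs₂⟩ := abs_le.1 hs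
  obtain ⟨ht₁, ht₂⟩ := abs_le.1 ht
  obtain rfl : β = (2 + a * (t - s)) / 2 := by linarith
  obtain rfl : x = (α * t + (2 - α) * s) / 2 := by linarith
  refine ⟨(α + t * a) / 2, (a + t * α) / 2, p / 2, ⟨by nlinarith, ?_⟩, ⟨by nlinarith, ?_⟩,
    ⟨by nlinarith, ?_⟩, ⟨by nlinarith, ?_⟩⟩
  · linear_combination hp / 4
  · linear_combination hp / 4
  · linear_combination hq / 4
  · linear_combination hq / 4

/-! ### Necessity of the bound on the perpendicular component -/

/-- Pairing a point of the light cone with the null vector of spinor `(u, v)`. -/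
theorem InCone.pairing_nonneg {c : ℝ} (h : InCone c x y) (u v : ℝ) :
    0 ≤ u ^ 2 * (c - x) + v ^ 2 * (c + x) - 2 * u * v * y := by
  obtain ⟨hc, h⟩ := h
  obtain ⟨hx₁, hx₂⟩ := abs_le.1 (abs_le_of_sq_le_sq (a := x) (by nlinarith [sq_nonneg y]) hc)
  rcases hx₂.eq_or_lt with rfl | hx
  · have hy : y = 0 := by nlinarith [sq_nonneg y]
    subst hy
    nlinarith [mul_nonneg (sq_nonneg v) hc]
  · have hx : 0 < c - x := by linarith
    refine nonneg_of_mul_nonneg_right (b := _) ?_ hx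
    nlinarith [sq_nonneg (u * (c - x) - v * y), mul_nonneg (sq_nonneg v) (sub_nonneg.2 h)]


/-- Let `(z₁, z₂)`, `(z₁', -z₂')`, `(y₁, y₂)`, `(y₁', -y₂')` be spinors of null vectors `P`, `P'`,
`Q`, `Q'` (up to the factor `1/2`) with `P + P' = A` and `Q + Q' = 1 - A`, such that `P + Q` and `B`
differ only in the perpendicular component. If `l P + m' Q' = m P' + l' Q`, then
`-l P + m P' = -l' Q + m' Q'` is a linear functional attaining at `P` its maximum over `[0, A]` and
at `Q` its maximum over `[0, 1 - A]`, hence at `P + Q` its maximum over all `B` coexistent with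
`A`. -/
theorem perp_le_of_balance {z₁ z₂ z₁' z₂' y₁ y₂ y₁' y₂' l m l' m' : ℝ}
    (h : PlanarCoexistent α a β x y)
    (hl : 0 ≤ l) (hm : 0 ≤ m) (hl' : 0 ≤ l') (hm' : 0 ≤ m')
    (hAp : 2 * (α + a) = z₁ ^ 2 + z₁' ^ 2) (hAm : 2 * (α - a) = z₂ ^ 2 + z₂' ^ 2)
    (hp : z₁ * z₂ = z₁' * z₂')
    (hAp' : 2 * (2 - α - a) = y₁ ^ 2 + y₁' ^ 2) (hAm' : 2 * (2 - α + a) = y₂ ^ 2 + y₂' ^ 2)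
    (hq : y₁ * y₂ = y₁' * y₂')
    (hBp : 2 * (β + x) = z₁ ^ 2 + y₁ ^ 2) (hBm : 2 * (β - x) = z₂ ^ 2 + y₂ ^ 2)
    (h₁ : l * z₁ ^ 2 + m' * y₁' ^ 2 = m * z₁' ^ 2 + l' * y₁ ^ 2)
    (h₂ : l * z₂ ^ 2 + m' * y₂' ^ 2 = m * z₂' ^ 2 + l' * y₂ ^ 2)
    (h₃ : l * (z₁ * z₂) - m' * (y₁' * y₂') = -(m * (z₁' * z₂')) + l' * (y₁ * y₂))
    (hpos : 0 < (l' + m') * (y₁ * y₂)) :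
    y ≤ (z₁ * z₂ + y₁ * y₂) / 2 := by
  obtain ⟨γ, p, r, c₁, c₂, c₃, c₄⟩ := h
  have k₁ := mul_nonneg hl (c₁.pairing_nonneg z₁ z₂)
  have k₂ := mul_nonneg hm (c₂.pairing_nonneg z₁' (-z₂'))
  have k₃ := mul_nonneg hl' (c₃.pairing_nonneg y₁ y₂)
  have k₄ := mul_nonneg hm' (c₄.pairing_nonneg y₁' (-y₂'))
  have key : 0 ≤ 2 * ((l' + m') * (y₁ * y₂)) * ((z₁ * z₂ + y₁ * y₂) / 2 - y) := by
    refine (add_nonneg (add_nonneg k₁ k₂) (add_nonneg k₃ k₄)).trans_eq ?_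
    linear_combination (γ - p - z₂ ^ 2 / 2) * h₁ + (γ + p - z₁ ^ 2 / 2) * h₂
      - 2 * (r - z₁ * z₂ / 2) * h₃ - m * (z₁' * z₂') * hp - m' * (y₁' * y₂') * hq
      + 2 * m' * (y - (z₁ * z₂ + y₁ * y₂) / 2) * hq
      + m * z₁' ^ 2 / 2 * hAm + m * z₂' ^ 2 / 2 * hAp + l' * y₁ ^ 2 / 2 * hBm
      + l' * y₂ ^ 2 / 2 * hBp + m' * y₁' ^ 2 / 2 * (hAm' - hBm) + m' * y₂' ^ 2 / 2 * (hAp' - hBp)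
  have := nonneg_of_mul_nonneg_right key (by linarith)
  linarith

/-- The inequality `hD`, equivalent to `|b_∥ - b₀| ≤ w`, says that `P` lies to the right of `Q` as a
direction on the light cone; together with the corresponding statement for `A - P` and `1 - A - Q`
it makes all coefficients of the linear relation between the four null vectors non-negative. -/
theorem perp_le_of_interlacing {s t p q : ℝ} (h : PlanarCoexistent α a β x y) (ha : 0 < a)
    (haα : a < α) (hα : α ≤ 1) (ht₁ : -1 < t) (hts : t ≤ s) (hs₁ : s < 1)
    (hp₀ : 0 ≤ p) (hp : p ^ 2 = (α ^ 2 - a ^ 2) * (1 - t ^ 2))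
    (hq₀ : 0 ≤ q) (hq : q ^ 2 = ((2 - α) ^ 2 - a ^ 2) * (1 - s ^ 2))
    (hβ : 2 * β = 2 + a * (t - s)) (hx : 2 * x = α * t + (2 - α) * s)
    (hD : (s - t) * (α * (2 - α) + a ^ 2) ≤ 2 * a * (1 - t * s)) :
    y ≤ (p + q) / 2 := by
  have e₁ : 0 < α + a := by linarith
  have e₂ : 0 < α - a := by linarith
  have e₃ : 0 < 2 - α - a := by linarith
  have e₄ : 0 < 2 - α + a := by linarith
  have t₁ : 0 < 1 + t := by linarith
  have t₂ : 0 < 1 - t := by linarith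
  have s₁ : 0 < 1 + s := by linarith
  have s₂ : 0 < 1 - s := by linarith
  have root : ∀ {u v : ℝ}, 0 < u → 0 < v → ∃ w : ℝ, 0 < w ∧ w ^ 2 = u * v := fun hu hv =>
    ⟨√(_ * _), Real.sqrt_pos.2 (mul_pos hu hv), Real.sq_sqrt (mul_pos hu hv).le⟩
  obtain ⟨z₁, z₁p, hz₁⟩ := root e₁ t₁
  obtain ⟨z₂, z₂p, hz₂⟩ := root e₂ t₂
  obtain ⟨z₁', z₁p', hz₁'⟩ := root e₁ t₂
  obtain ⟨z₂', z₂p', hz₂'⟩ := root e₂ t₁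
  obtain ⟨y₁, y₁p, hy₁⟩ := root e₃ s₁
  obtain ⟨y₂, y₂p, hy₂⟩ := root e₄ s₂
  obtain ⟨y₁', y₁p', hy₁'⟩ := root e₃ s₂
  obtain ⟨y₂', y₂p', hy₂'⟩ := root e₄ s₁
  have eq_of_sq : ∀ {u v : ℝ}, 0 ≤ u → 0 ≤ v → u ^ 2 = v ^ 2 → u = v := fun hu hv h =>
    (pow_left_inj₀ hu hv two_ne_zero).1 h
  have hpz : p = z₁ * z₂ := eq_of_sq hp₀ (by positivity) (by rw [mul_pow, hz₁, hz₂, hp]; ring)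
  have hpz' : z₁ * z₂ = z₁' * z₂' := eq_of_sq (by positivity) (by positivity) (by
    rw [mul_pow, mul_pow, hz₁, hz₂, hz₁', hz₂']; ring)
  have hqy : q = y₁ * y₂ := eq_of_sq hq₀ (by positivity) (by rw [mul_pow, hy₁, hy₂, hq]; ring)
  have hqy' : y₁ * y₂ = y₁' * y₂' := eq_of_sq (by positivity) (by positivity) (by
    rw [mul_pow, mul_pow, hy₁, hy₂, hy₁', hy₂']; ring)
  -- the spinors are in the angular order `Q'`, `P'`, `P`, `Q`, so all brackets (determinants) of
  -- pairs in this order are non-negative; only those of `P`, `Q` and of `Q'`, `P'` need `hD`, `hts`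
  have hts₀ : 0 < 1 - t * s := by
    linear_combination (mul_pos t₁ s₂ + mul_pos t₂ s₁) / 2
  have b₃₄ : 0 ≤ z₁ * y₂ - z₂ * y₁ := by
    refine sub_nonneg.2 ((pow_le_pow_iff_left₀ (by positivity) (by positivity) two_ne_zero).1 ?_)
    rw [mul_pow, mul_pow, hz₁, hz₂, hy₁, hy₂]
    linear_combination 2 * hD
  have b₁₂ : 0 < y₂' * z₁' - y₁' * z₂' := by
    refine sub_pos.2 ((pow_lt_pow_iff_left₀ (by positivity) (by positivity) two_ne_zero).1 ?_)
    rw [mul_pow, mul_pow, hz₁', hz₂', hy₁', hy₂']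
    have h₁ := mul_pos ha hts₀
    have h₂ : 0 ≤ (s - t) * (α * (2 - α) + a ^ 2) :=
      mul_nonneg (sub_nonneg.2 hts)
      (add_nonneg (mul_nonneg (ha.trans haα).le (by linarith)) (sq_nonneg a))
    linear_combination 4 * h₁ + 2 * h₂
  have b₁₃ : 0 < y₁' * z₂ + y₂' * z₁ := by positivity
  have b₁₄ : 0 < y₁' * y₂ + y₂' * y₁ := by positivity
  have b₂₃ : 0 < z₁' * z₂ + z₂' * z₁ := by positivity
  have b₂₄ : 0 < z₁' * y₂ + z₂' * y₁ := by positivity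
  rw [hpz, hqy]
  -- the squares of four vectors of a plane are linearly dependent, with products of three brackets
  -- as coefficients
  refine perp_le_of_balance
    (l := (y₂' * z₁' - y₁' * z₂') * (y₁' * y₂ + y₂' * y₁) * (z₁' * y₂ + z₂' * y₁))
    (m := (y₁' * z₂ + y₂' * z₁) * (y₁' * y₂ + y₂' * y₁) * (z₁ * y₂ - z₂ * y₁))
    (l' := (y₂' * z₁' - y₁' * z₂') * (y₁' * z₂ + y₂' * z₁) * (z₁' * z₂ + z₂' * z₁))
    (m' := (z₁' * z₂ + z₂' * z₁) * (z₁' * y₂ + z₂' * y₁) * (z₁ * y₂ - z₂ * y₁))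
    h (by positivity) (by positivity) (by positivity) (by positivity)
    (by rw [hz₁, hz₁']; ring) (by rw [hz₂, hz₂']; ring) hpz' (by rw [hy₁, hy₁']; ring)
    (by rw [hy₂, hy₂']; ring) hqy' (by rw [hz₁, hy₁]; linear_combination hβ + hx) (by rw [hz₂, hy₂]; linear_combination hβ - hx)
    (by ring) (by ring) (by ring) (by positivity)

/-- If `A` is a multiple of a projection, then `[0, A]` is a segment, and the constraints on `B - G`
and `1 - A - B + G` are linear in the position of `G` on it. -/
theorem perp_sq_le_of_rank_one (h : PlanarCoexistent a a β x y) (hx : |x| ≤ β) (hβ : β ≤ 1) :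
    y ^ 2 ≤ (1 - a) * ((β - x) * (2 - β + x)) := by
  obtain ⟨γ, p, r, c₁, c₂, c₃, c₄⟩ := h
  have k₁ := c₁.pairing_nonneg 1 0
  have k₂ := c₂.pairing_nonneg 1 0
  obtain rfl : p = γ := by linarith
  obtain rfl : r = 0 := by nlinarith [c₁.2]
  obtain ⟨hx₁, hx₂⟩ := abs_le.1 hx
  have m₁ := mul_le_mul_of_nonneg_left c₃.2 (by linarith : 0 ≤ 2 - β + x)
  have m₂ := mul_le_mul_of_nonneg_left c₄.2 (by linarith : 0 ≤ β - x)
  linear_combination (m₁ + m₂) / 2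

/-! ### The closed-form expressions -/

theorem sharpnessRad_nonneg (ha : 0 ≤ a) (haα : a ≤ α) (hα : α ≤ 1) : 0 ≤ sharpnessRad α a :=
  mul_nonneg (by nlinarith) (by nlinarith)

/-- `1 - 𝔖(A)` is the larger root of the quadratic polynomial `widthRad` in `β`. -/
theorem four_mul_widthRad (ha : 0 ≤ a) (haα : a ≤ α) (hα : α ≤ 1) :
    4 * widthRad α a β = (2 * β - (1 + (1 - α) ^ 2 - a ^ 2)) ^ 2 - √(sharpnessRad α a) ^ 2 := by
  rw [Real.sq_sqrt (sharpnessRad_nonneg ha haα hα), widthRad, sharpnessRad]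
  ring

theorem widthRad_pos (ha : 0 ≤ a) (haα : a ≤ α) (hα : α ≤ 1) (h : 1 - sharpness α a < β) :
    0 < widthRad α a β := by
  have h₁ := four_mul_widthRad (β := β) ha haα hα
  have h₂ := Real.sqrt_nonneg (sharpnessRad α a)
  rw [sharpness] at h
  nlinarith

/-- The polynomial `widthRad` is not positive at `1 - a`, so `1 - a ≤ 1 - 𝔖(A)`. -/
theorem one_sub_lt (ha : 0 ≤ a) (haα : a ≤ α) (hα : α ≤ 1) (h : 1 - sharpness α a < β) :
    1 - β < a := by
  have h₁ : 2 * (1 - a) - (1 + (1 - α) ^ 2 - a ^ 2) ≤ √(sharpnessRad α a) := by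
    refine (le_abs_self _).trans (Real.abs_le_sqrt ?_)
    rw [sharpnessRad]
    have : 0 ≤ a * ((α - a) * (2 - α - a)) :=
      mul_nonneg ha (mul_nonneg (by linarith) (by linarith))
    linear_combination 4 * this
  rw [sharpness] at h
  linarith

theorem mul_sub_bZero (ha : 0 < a) : a * (x - bZero α a β) = a * x - (1 - α) * (1 - β) := by
  rw [bZero]
  field_simp

theorem width_le_iff (ha : 0 < a) : width α a β ≤ |x - bZero α a β| ↔
    widthRad α a β ≤ (a * x - (1 - α) * (1 - β)) ^ 2 := by
  rw [width, one_div, inv_mul_le_iff₀ ha, ← mul_sub_bZero ha, Real.sqrt_le_iff]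
  have h : a * |x - bZero α a β| = |a * (x - bZero α a β)| := by rw [abs_mul, abs_of_pos ha]
  rw [h, sq_abs]
  exact and_iff_right (abs_nonneg _)

theorem add_le_of_lt_width (ha : 0 < a) (haα : a ≤ α) (hα : α ≤ 1) (hβ : β ≤ 1)
    (h : 1 - sharpness α a < β) (hx : |x - bZero α a β| < width α a β) :
    |a * (x - bZero α a β)| + (1 - β) < a := by
  have h₁ := one_sub_lt ha.le haα hα h
  rw [width, one_div, lt_inv_mul_iff₀ ha] at hx
  have h₂ : √(widthRad α a β) ≤ a - (1 - β) := by
    refine Real.sqrt_le_iff.2 ⟨by linarith, ?_⟩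
    have : 0 ≤ (1 - β) * ((α - a) * (2 - α - a)) :=
      mul_nonneg (by linarith) (mul_nonneg (by linarith) (by linarith))
    rw [widthRad]
    linear_combination this
  rw [abs_mul, abs_of_pos ha]
  linarith

theorem perpMaxRad_nonneg (ha : 0 < a) (haα : a ≤ α) (hα : α ≤ 1) (hβ : β ≤ 1)
    (h : 1 - sharpness α a < β) (hx : |x - bZero α a β| < width α a β) :
    0 ≤ perpMaxRad₁ α a β x ∧ 0 ≤ perpMaxRad₂ α a β x := by
  have h₁ := add_le_of_lt_width ha haα hα hβ h hx
  obtain ⟨h₂, h₃⟩ := abs_le.1 (le_refl |a * (x - bZero α a β)|)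
  constructor
  · exact mul_nonneg (by nlinarith) (sub_nonneg.2 (sq_le_sq' (by linarith) (by linarith)))
  · exact mul_nonneg (by nlinarith) (sub_nonneg.2 (sq_le_sq' (by linarith) (by linarith)))

/-! ### The characterization -/

theorem planarCoexistent_of_widthRad_le (ha : 0 ≤ a) (haα : a ≤ α) (hα : α ≤ 1) (hβ₀ : 0 < β)
    (hβ : β ≤ 1) (hxy : x ^ 2 + y ^ 2 ≤ β ^ 2)
    (h : widthRad α a β ≤ (a * x - (1 - α) * (1 - β)) ^ 2) : PlanarCoexistent α a β x y := by
  refine planarCoexistent_of_le ha haα hα hβ₀ hβ hxy ?_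
  rw [widthRad] at h
  linear_combination 4 * h

theorem planarCoexistent_of_le_one_sub_sharpness (ha : 0 ≤ a) (haα : a ≤ α) (hα : α ≤ 1)
    (hβ₀ : 0 < β) (hβ : β ≤ 1) (hxy : x ^ 2 + y ^ 2 ≤ β ^ 2) (h : β ≤ 1 - sharpness α a) :
    PlanarCoexistent α a β x y := by
  refine planarCoexistent_of_le ha haα hα hβ₀ hβ hxy ?_
  obtain ⟨n, hn, rfl⟩ : ∃ n, n ^ 2 ≤ 1 ∧ x = β * n := by
    refine ⟨x / β, ?_, by field_simp⟩
    rw [div_pow]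
    exact div_le_one_of_le₀ (by nlinarith [sq_nonneg y]) (sq_nonneg β)
  obtain ⟨hn₁, hn₂⟩ := abs_le.1 ((sq_le_one_iff_abs_le_one n).1 hn)
  have hU : 0 ≤ α - a * n := by nlinarith
  have hV : 0 ≤ 2 - α + a * n := by nlinarith
  -- the condition scales linearly with `B`, and at the trace `1 - 𝔖(A)` it holds for every
  -- direction of `B` because `widthRad` vanishes there
  set β' := 1 - sharpness α a with hβ'
  have hw : widthRad α a β' = 0 := by
    have h₁ := four_mul_widthRad (β := β') ha haα hα
    have h₂ : 2 * β' - (1 + (1 - α) ^ 2 - a ^ 2) = √(sharpnessRad α a) := by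
      rw [hβ', sharpness]; ring
    rw [h₂, sub_self] at h₁
    linarith
  have h₁ : 0 ≤ β' * ((α ^ 2 - a ^ 2) * (2 * (2 - α + a * n)) +
      ((2 - α) ^ 2 - a ^ 2) * (2 * (α - a * n)) -
      β' * (2 * (α - a * n) * (2 * (2 - α + a * n)))) := by
    have := sq_nonneg (a * (β' * n) - (1 - α) * (1 - β'))
    rw [widthRad] at hw
    linear_combination 4 * this + 4 * hw
  have h₂ := nonneg_of_mul_nonneg_right h₁ (hβ₀.trans_le h)
  have h₃ := mul_le_mul_of_nonneg_right h (mul_nonneg hU hV)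
  have h₄ : 0 ≤ (α ^ 2 - a ^ 2) * (2 * (2 - α + a * n)) +
      ((2 - α) ^ 2 - a ^ 2) * (2 * (α - a * n)) -
      β * (2 * (α - a * n) * (2 * (2 - α + a * n))) := by
    linear_combination h₂ + 4 * h₃
  linear_combination mul_nonneg hβ₀.le h₄

/-- The coordinates `s`, `t` on the two ellipses of the point with given trace `β` and parallel
component `x`, and twice the heights `q`, `p` of the ellipses there. -/
theorem exists_ellipse_coordinates (ha : 0 < a) (haα : a ≤ α) (hα : α ≤ 1) (hβ : β ≤ 1)
    (h : 1 - sharpness α a < β) (hx : |x - bZero α a β| < width α a β) :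
    ∃ s t p q : ℝ, -1 < t ∧ t ≤ s ∧ s < 1 ∧
      0 ≤ p ∧ p ^ 2 = (α ^ 2 - a ^ 2) * (1 - t ^ 2) ∧
      0 ≤ q ∧ q ^ 2 = ((2 - α) ^ 2 - a ^ 2) * (1 - s ^ 2) ∧
      2 * β = 2 + a * (t - s) ∧ 2 * x = α * t + (2 - α) * s ∧
      (s - t) * (α * (2 - α) + a ^ 2) ≤ 2 * a * (1 - t * s) ∧
      perpMax α a β x = (p + q) / 2 := by
  have h₁ := add_le_of_lt_width ha haα hα hβ h hx
  have h₀ : (a * x - (1 - α) * (1 - β)) ^ 2 ≤ widthRad α a β :=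
    (not_le.1 (mt (width_le_iff ha).2 hx.not_ge)).le
  obtain ⟨hr₁, hr₂⟩ := perpMaxRad_nonneg ha haα hα hβ h hx
  obtain ⟨h₂, h₃⟩ := abs_le.1 (le_refl |a * (x - bZero α a β)|)
  have hξ := mul_sub_bZero (α := α) (β := β) (x := x) ha
  obtain ⟨u, hu⟩ : ∃ u, u = x - bZero α a β := ⟨_, rfl⟩
  obtain ⟨d, hd⟩ : ∃ d, 1 - β = a * d := ⟨(1 - β) / a, by field_simp⟩
  rw [← hu] at h₁ h₂ h₃ hξ
  have hd0 : 0 ≤ d := nonneg_of_mul_nonneg_right (hd ▸ by linarith) ha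
  have hx' : x = u + (1 - α) * d := mul_left_cancel₀ ha.ne' (by rw [hd] at hξ; linarith)
  refine ⟨u + d, u - d, √(perpMaxRad₂ α a β x) / a, √(perpMaxRad₁ α a β x) / a,
    ?_, by linarith, ?_, by positivity, ?_, by positivity, ?_, ?_, ?_, ?_, ?_⟩
  · refine lt_of_mul_lt_mul_left ?_ ha.le
    linarith
  · refine lt_of_mul_lt_mul_left ?_ ha.le
    linarith
  · rw [div_pow, Real.sq_sqrt hr₂, perpMaxRad₂, ← hu, hd]
    field_simp
  · rw [div_pow, Real.sq_sqrt hr₁, perpMaxRad₁, ← hu, hd]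
    field_simp
  · linear_combination -2 * hd
  · linear_combination 2 * hx'
  · refine le_of_mul_le_mul_left ?_ ha
    rw [← hξ, widthRad] at h₀
    obtain rfl : β = 1 - a * d := by linarith
    linear_combination 2 * h₀
  · rw [perpMax]
    field_simp
    ring

theorem planarCoexistent_of_le_perpMax (ha : 0 < a) (haα : a ≤ α) (hα : α ≤ 1) (hβ : β ≤ 1)
    (h : 1 - sharpness α a < β) (hx : |x - bZero α a β| < width α a β) (hy₀ : 0 ≤ y)
    (hy : y ≤ perpMax α a β x) : PlanarCoexistent α a β x y := by
  obtain ⟨s, t, p, q, ht₁, hts, hs₁, hp₀, hp, hq₀, hq, h₁, h₂, -, h₃⟩ :=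
    exists_ellipse_coordinates ha haα hα hβ h hx
  have key := planarCoexistent_of_ellipses ha.le haα hα
    (abs_le.2 ⟨by linarith, hs₁.le⟩) (abs_le.2 ⟨ht₁.le, by linarith⟩) hp hq h₁ h₂
  refine key.of_abs_le ?_
  rw [← h₃, abs_of_nonneg hy₀]
  exact hy.trans (le_abs_self _)

theorem le_perpMax_of_planarCoexistent (ha : 0 < a) (haα : a ≤ α) (hα : α ≤ 1) (hβ₀ : 0 ≤ β)
    (hβ : β ≤ 1) (h : 1 - sharpness α a < β) (hx : |x - bZero α a β| < width α a β)
    (hxy : x ^ 2 + y ^ 2 ≤ β ^ 2) (hc : PlanarCoexistent α a β x y) : y ≤ perpMax α a β x := by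
  obtain ⟨s, t, p, q, ht₁, hts, hs₁, hp₀, hp, hq₀, hq, h₁, h₂, h₃, h₄⟩ :=
    exists_ellipse_coordinates ha haα hα hβ h hx
  rw [h₄]
  rcases haα.eq_or_lt with rfl | haα
  · have hx' : |x| ≤ β := abs_le_of_sq_le_sq (by nlinarith [sq_nonneg y]) hβ₀
    have hp' : p = 0 := by
      rw [sub_self, zero_mul] at hp
      exact pow_eq_zero_iff two_ne_zero |>.1 hp
    have h₅ := perp_sq_le_of_rank_one hc hx' hβ
    have h₆ : y ^ 2 ≤ (q / 2) ^ 2 := by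
      obtain rfl : β = (2 + a * (t - s)) / 2 := by linarith
      obtain rfl : x = (a * t + (2 - a) * s) / 2 := by linarith
      linear_combination h₅ - hq / 4
    rw [hp', zero_add]
    exact abs_le_of_sq_le_sq' h₆ (by positivity) |>.2
  · exact perp_le_of_interlacing hc ha haα hα ht₁ hts hs₁ hp₀ hp hq₀ hq h₁ h₂ h₃

theorem coexistent_iff_planarCoexistent_of_ne_zero {a b : EuclideanSpace ℝ (Fin 3)} (ha : a ≠ 0) :
    Coexistent (qubitOp α a) (qubitOp β b) ↔
      PlanarCoexistent α ‖a‖ β (bPar a b) (bPerp a b) := by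
  have h0 := norm_ne_zero_iff.2 ha
  have hx : inner ℝ (‖a‖⁻¹ • a) b = bPar a b := by
    rw [real_inner_smul_left, bPar, div_eq_inv_mul]
  have hy : b - bPar a b • ‖a‖⁻¹ • a = b - (inner ℝ a b / ‖a‖ ^ 2) • a := by
    rw [smul_smul, bPar]
    congr 2
    field_simp
  rw [coexistent_iff_planarCoexistent (e := ‖a‖⁻¹ • a) (norm_smul_inv_norm ha)
    (smul_inv_smul₀ h0 a).symm, hx, hy, bPerp]

theorem bPar_sq_add_bPerp_sq {a b : EuclideanSpace ℝ (Fin 3)} (ha : a ≠ 0) :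
    bPar a b ^ 2 + bPerp a b ^ 2 = ‖b‖ ^ 2 := by
  have h0 := norm_ne_zero_iff.2 ha
  rw [bPar, bPerp, norm_sub_sq_real, real_inner_smul_right, norm_smul, mul_pow,
    Real.norm_eq_abs, sq_abs, real_inner_comm]
  field_simp
  ring

end QubitCoexistence

end

open QubitCoexistence
theorem theorem1 (α β : ℝ) (a b : EuclideanSpace ℝ (Fin 3))
    (hα₀ : 0 < α) (hα₁ : α ≤ 1) (hβ₀ : 0 < β) (hβ₁ : β ≤ 1)
    (hA : IsEffect (qubitOp α a)) (hB : IsEffect (qubitOp β b)) :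
    -- the characterization
    (Coexistent (qubitOp α a) (qubitOp β b) ↔ C1 α a β ∨ C2 α a β b ∨ C3 α a β b) ∧
    -- the three cases are disjoint
    (¬ (C1 α a β ∧ C2 α a β b) ∧ ¬ (C1 α a β ∧ C3 α a β b) ∧ ¬ (C2 α a β b ∧ C3 α a β b)) ∧
    -- the closed-form expressions are well defined wherever they are used
    (0 ≤ sharpnessRad α ‖a‖ ∧
      (1 - sharpness α ‖a‖ < β →
        a ≠ 0 ∧ 0 ≤ widthRad α ‖a‖ β ∧
        (|bPar a b - bZero α ‖a‖ β| < width α ‖a‖ β →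
          0 ≤ perpMaxRad₁ α ‖a‖ β (bPar a b) ∧ 0 ≤ perpMaxRad₂ α ‖a‖ β (bPar a b)))) := by
  have haα : ‖a‖ ≤ α := (isEffect_qubitOp_iff.1 hA).1
  have hbβ : ‖b‖ ≤ β := (isEffect_qubitOp_iff.1 hB).1
  have ha := norm_nonneg a
  have ha0 : 1 - sharpness α ‖a‖ < β → 0 < ‖a‖ := fun h => by
    linarith [one_sub_lt ha haα hα₁ h]
  have hxy : a ≠ 0 → bPar a b ^ 2 + bPerp a b ^ 2 ≤ β ^ 2 := fun h => by
    rw [bPar_sq_add_bPerp_sq h]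
    exact pow_le_pow_left₀ (norm_nonneg b) hbβ 2
  refine ⟨⟨fun h => ?_, ?_⟩, ⟨?_, ?_, ?_⟩, sharpnessRad_nonneg ha haα hα₁, fun h =>
    ⟨norm_pos_iff.1 (ha0 h), (widthRad_pos ha haα hα₁ h).le,
      perpMaxRad_nonneg (ha0 h) haα hα₁ hβ₁ h⟩⟩
  · rcases le_or_gt β (1 - sharpness α ‖a‖) with h₁ | h₁
    · exact Or.inl h₁
    rcases le_or_gt (width α ‖a‖ β) |bPar a b - bZero α ‖a‖ β| with h₂ | h₂
    · exact Or.inr (Or.inl ⟨h₁, h₂⟩)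
    have hne := norm_pos_iff.1 (ha0 h₁)
    exact Or.inr (Or.inr ⟨h₁, h₂, le_perpMax_of_planarCoexistent (ha0 h₁) haα hα₁ hβ₀.le hβ₁ h₁ h₂
      (hxy hne) ((coexistent_iff_planarCoexistent_of_ne_zero hne).1 h)⟩)
  · rintro (h | ⟨h₁, h₂⟩ | ⟨h₁, h₂, h₃⟩)
    · obtain ⟨e, he, hae⟩ : ∃ e : EuclideanSpace ℝ (Fin 3), ‖e‖ = 1 ∧ a = ‖a‖ • e := by
        rcases eq_or_ne a 0 with rfl | h0
        · exact ⟨EuclideanSpace.single 0 1, by simp, by simp⟩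
        · exact ⟨‖a‖⁻¹ • a, norm_smul_inv_norm h0,
            (smul_inv_smul₀ (norm_ne_zero_iff.2 h0) a).symm⟩
      rw [coexistent_iff_planarCoexistent he hae]
      refine planarCoexistent_of_le_one_sub_sharpness ha haα hα₁ hβ₀ hβ₁ ?_ h
      obtain ⟨n, hn, hen, hb⟩ := exists_unit_orthogonal he b
      rw [← norm_sq_smul_add_smul he hn hen, ← hb]
      exact pow_le_pow_left₀ (norm_nonneg b) hbβ 2
    · have hne := norm_pos_iff.1 (ha0 h₁)
      exact (coexistent_iff_planarCoexistent_of_ne_zero hne).2 (planarCoexistent_of_widthRad_le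
        ha haα hα₁ hβ₀ hβ₁ (hxy hne) ((width_le_iff (ha0 h₁)).1 h₂))
    · exact (coexistent_iff_planarCoexistent_of_ne_zero (norm_pos_iff.1 (ha0 h₁))).2
        (planarCoexistent_of_le_perpMax (ha0 h₁) haα hα₁ hβ₁ h₁ h₂ (norm_nonneg _) h₃)
  · exact fun h => h.1.not_gt h.2.1
  · exact fun h => h.1.not_gt h.2.1
  · exact fun h => h.1.2.not_gt h.2.2.1
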